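/- For a positive integer $k$ and a finite set $X\subseteq[0,1]^k$ with $|X|\ge 2$, let $s_k^{\mathrm{ST}}(X)$ be the minimum of $\bigl(\sum_{xy\in E(T)}|x-y|^k\bigr)^{1/k}$ over all trees $T$ with vertex set $X$, where $|\cdot|$ is the Euclidean norm. For $n \ge 2$ let $s_k^{\mathrm{ST}}(n)=\sup\{s_k^{\mathrm{ST}}(X): X\subseteq[0,1]^k,\ |X|=n\}$, and let $s_k^{\mathrm{ST}}=\sup_{n\ge 2}s_k^{\mathrm{ST}}(n)$. Then $$s_k^{\mathrm{ST}}\le\sqrt{k}\,(1+o_k(1)),$$ that is, there is a sequence of real numbers $\varepsilon_k$ with $\varepsilon_k\to0$ as $k\to\infty$ such that $s_k^{\mathrm{ST}}\le\sqrt{k}\,(1+\varepsilon_k)$ for every $k\ge1$ (in particular every $s_k^{\mathrm{ST}}$ is finite). Apart from the error term, this bound is best possible: $s_k^{\mathrm{ST}}\ge\sqrt{k}$ for every $k\ge1$. -/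

import Mathlib

open Filter Topology

noncomputable section

/-- The unit cube `[0,1]^k` in Euclidean `k`-space. -/
def unitCube (k : ℕ) : Set (EuclideanSpace ℝ (Fin k)) :=
  {x | ∀ i, x i ∈ Set.Icc (0 : ℝ) 1}

/-- The Euclidean length `|e| = |x - y|` of an edge `e = xy` between two points of `X`. -/
def edgeLength {k : ℕ} {X : Finset (EuclideanSpace ℝ (Fin k))} (e : Sym2 X) : ℝ :=
  Sym2.lift ⟨fun x y : X => dist (x : EuclideanSpace ℝ (Fin k)) (y : EuclideanSpace ℝ (Fin k)),
    fun _ _ => dist_comm _ _⟩ e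

open Classical in
/-- The unscaled cost `S_k(G) = ∑_{e ∈ G} |e|^k` of a graph `G` with vertex set `X ⊆ ℝ^k`. -/
def unscaledCost {k : ℕ} {X : Finset (EuclideanSpace ℝ (Fin k))} (G : SimpleGraph X) : ℝ :=
  ∑ e ∈ G.edgeFinset, edgeLength e ^ k

/-- The scaled cost `s_k(G) = S_k(G)^(1/k)`. -/
def scaledCost {k : ℕ} {X : Finset (EuclideanSpace ℝ (Fin k))} (G : SimpleGraph X) : ℝ :=
  unscaledCost G ^ (1 / (k : ℝ))

/-- `s_k^ST(X)`: the least scaled cost of a spanning tree with vertex set `X`. There are finitely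
many graphs on `X`, and at least one tree if `X` is nonempty, so the infimum is a minimum. -/
def stCost {k : ℕ} (X : Finset (EuclideanSpace ℝ (Fin k))) : ENNReal :=
  ⨅ (G : SimpleGraph X) (_ : G.IsTree), ENNReal.ofReal (scaledCost G)

/-- `s_k^ST(n)`: the supremum of `s_k^ST(X)` over the `n`-element sets `X ⊆ [0,1]^k`. -/
def stSupCard (k n : ℕ) : ENNReal :=
  ⨆ (X : Finset (EuclideanSpace ℝ (Fin k))) (_ : (X : Set (EuclideanSpace ℝ (Fin k))) ⊆ unitCube k)
    (_ : X.card = n), stCost X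

/-- `s_k^ST`: the supremum of `s_k^ST(n)` over `n ≥ 2`, with values in `[0, ∞]`. -/
def stSup (k : ℕ) : ENNReal :=
  ⨆ (n : ℕ) (_ : 2 ≤ n), stSupCard k n

end

/-! Prim's tree attains the upper bound. Let `d_i` be the length of the edge attaching the `i`-th
point and `s_i = d_i / √k ≤ 1`. It is enough that `∑ s_i ^ k ≤ 2000 k`, because the `k`-th root of
`2000 k` tends to 1.

The main tool is a volume bound, `sum_side_pow_le`. If `|p_i - p_j| ≥ max (r_i, r_j)`, then by
Rankin at most six balls of squared radius `5/12 r_i ^ 2` about the `p_i` share a point. A box of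
side `a` centred at `p` has mean square distance only `k a ^ 2 / 12` from `p`, so a fixed proportion
of a suitable box lies in such a ball, with no loss exponential in `k`.

For short edges the bound is applied to edge midpoints, which are separated by half the longer of
the two edges (`max_le_two_mul_dist_midpoint`). For long edges it is applied to the vertices, which
are separated only by the shorter edge. This gives at most `30 t ^ (-k)` edges with `s_i ≥ t`;
summing costs the logarithm of the number of long edges, which is linear in `k`.

Two opposite corners of the cube give the lower bound. -/

/-! ### Prim's ordering and its tree -/

/-- Prim's ordering of a finite metric space: each new point is attached to an earlier one by a
shortest edge leaving the set of earlier points. -/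
theorem exists_prim_prefix {α : Type*} [Fintype α] [DecidableEq α] [Nonempty α] [PseudoMetricSpace α]
    (m : ℕ) (hm : m ≤ Fintype.card α) :
    ∃ (v : ℕ → α) (par : ℕ → ℕ), Set.InjOn v (Finset.range m) ∧
      (∀ i, 0 < i → i < m → par i < i) ∧
      ∀ i, 0 < i → i < m → ∀ a < i, ∀ x, x ∉ (Finset.range i).image v →
        dist (v i) (v (par i)) ≤ dist x (v a) := by
  induction m with
  | zero => exact ⟨fun _ => Classical.arbitrary α, id, by simp, by simp, by simp⟩
  | succ m ih =>
    obtain ⟨v, par, hinj, hpar, hmin⟩ := ih (by omega)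
    rcases Nat.eq_zero_or_pos m with rfl | hm0
    · exact ⟨v, par, by simp, fun i _ _ => by omega, fun i _ _ => by omega⟩
    set S := (Finset.range m).image v with hS
    have hScard : S.card = m := by
      rw [hS, Finset.card_image_of_injOn hinj, Finset.card_range]
    have hne : (Sᶜ ×ˢ Finset.range m).Nonempty := by
      refine Finset.Nonempty.product ?_ ⟨0, by simpa using hm0⟩
      rw [← Finset.card_pos, Finset.card_compl]
      omega
    obtain ⟨⟨z, b⟩, hzb, hzmin⟩ :=
      Finset.exists_min_image (Sᶜ ×ˢ Finset.range m) (fun q => dist q.1 (v q.2)) hne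
    simp only [Finset.mem_product, Finset.mem_compl, Finset.mem_range, Prod.forall] at hzb hzmin
    have himg : ∀ i ≤ m,
        (Finset.range i).image (Function.update v m z) = (Finset.range i).image v := by
      intro i hi
      refine Finset.image_congr fun j hj => ?_
      have : j < i := by simpa using hj
      exact Function.update_of_ne (by omega) _ _
    refine ⟨Function.update v m z, Function.update par m b, ?_, ?_, ?_⟩
    · rw [Finset.range_add_one, Finset.coe_insert, Set.injOn_insert (by simp)]
      refine ⟨?_, ?_⟩
      · refine hinj.congr fun j hj => ?_
        have : j < m := by simpa using hj
        exact (Function.update_of_ne (by omega) _ _).symm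
      · rw [← Finset.coe_image, himg m le_rfl]
        rw [Function.update_self]
        exact fun h => hzb.1 (Finset.mem_coe.1 h)
    · intro i hi0 him
      rcases eq_or_ne i m with rfl | hne
      · simpa using hzb.2
      · rw [Function.update_of_ne hne]
        exact hpar i hi0 (by omega)
    · intro i hi0 him a ha x hx
      rw [himg i (by omega)] at hx
      rw [Function.update_of_ne (show a ≠ m by omega)]
      rcases eq_or_ne i m with rfl | hne
      · rw [Function.update_self, Function.update_self,
          Function.update_of_ne (show b ≠ i by omega)]
        exact hzmin x a ⟨hx, ha⟩
      · have := hpar i hi0 (by omega)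
        rw [Function.update_of_ne hne, Function.update_of_ne hne,
          Function.update_of_ne (show par i ≠ m by omega)]
        exact hmin i hi0 (by omega) a ha x hx

/-- When `v i` is chosen, every `v j` with `j ≥ i` is still outside the tree, so `v j` and an
earlier `v a` compete with the chosen edge. All separation estimates come from this inequality. -/
theorem exists_prim {α : Type*} [Fintype α] [DecidableEq α] [Nonempty α] [PseudoMetricSpace α] :
    ∃ (v : ℕ → α) (par : ℕ → ℕ), Set.InjOn v (Finset.range (Fintype.card α)) ∧
      (∀ i, 0 < i → i < Fintype.card α → par i < i) ∧
      ∀ a i j, a < i → i ≤ j → j < Fintype.card α →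
        dist (v i) (v (par i)) ≤ dist (v j) (v a) := by
  obtain ⟨v, par, hinj, hpar, hmin⟩ := exists_prim_prefix (α := α) (Fintype.card α) le_rfl
  refine ⟨v, par, hinj, hpar, fun a i j ha hij hj => hmin i (by omega) (by omega) a ha _ ?_⟩
  intro hmem
  obtain ⟨b, hb, hbj⟩ := Finset.mem_image.1 hmem
  rw [Finset.mem_range] at hb
  have := hinj (by simp; omega) (by simpa using hj) hbj
  omega

open Classical in
/-- A parent function on an enumerated finite type defines a tree. -/
theorem exists_isTree_of_parent {α : Type*} [Fintype α] [Nonempty α] (v : ℕ → α) (par : ℕ → ℕ)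
    (hinj : Set.InjOn v (Finset.range (Fintype.card α)))
    (hpar : ∀ i, 0 < i → i < Fintype.card α → par i < i) :
    ∃ G : SimpleGraph α, G.IsTree ∧
      ∀ e ∈ G.edgeSet, ∃ i ∈ Finset.Ico 1 (Fintype.card α), s(v i, v (par i)) = e := by
  set n := Fintype.card α with hn
  set T := (Finset.Ico 1 n).image fun i => s(v i, v (par i)) with hT
  set G := SimpleGraph.fromEdgeSet (T : Set (Sym2 α)) with hG
  have hsub : G.edgeFinset ⊆ T := by
    intro e he
    rw [SimpleGraph.mem_edgeFinset, hG, SimpleGraph.edgeSet_fromEdgeSet] at he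
    exact he.1
  have hsurj : ∀ x, ∃ i < n, v i = x := by
    have himg : (Finset.range n).image v = Finset.univ := by
      rw [← Finset.card_eq_iff_eq_univ, Finset.card_image_of_injOn hinj, Finset.card_range]
    intro x
    have : x ∈ (Finset.range n).image v := himg ▸ Finset.mem_univ x
    simpa using this
  have hreach : ∀ i < n, G.Reachable (v i) (v 0) := by
    intro i
    induction i using Nat.strong_induction_on with
    | _ i ih =>
      intro hi
      rcases Nat.eq_zero_or_pos i with rfl | hi0
      · rfl
      · have hp := hpar i hi0 hi
        refine SimpleGraph.Reachable.trans (SimpleGraph.Adj.reachable ?_) (ih _ hp (by omega))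
        rw [hG, SimpleGraph.fromEdgeSet_adj]
        refine ⟨?_, fun h => ?_⟩
        · exact Finset.mem_coe.2 (Finset.mem_image.2 ⟨i, by simp; omega, rfl⟩)
        · have := hinj (by simpa using hi) (by simp; omega) h
          omega
  have hconn : G.Connected := by
    refine ⟨fun x y => ?_⟩
    obtain ⟨i, hi, rfl⟩ := hsurj x
    obtain ⟨j, hj, rfl⟩ := hsurj y
    exact (hreach i hi).trans (hreach j hj).symm
  refine ⟨G, ?_, fun e he => Finset.mem_image.1 (hsub (SimpleGraph.mem_edgeFinset.2 he))⟩
  rw [SimpleGraph.isTree_iff_connected_and_card]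
  refine ⟨hconn, ?_⟩
  have h1 := hconn.card_vert_le_card_edgeSet_add_one
  have h2 : Nat.card G.edgeSet ≤ n - 1 := by
    rw [Nat.card_eq_fintype_card, ← SimpleGraph.edgeFinset_card]
    refine (Finset.card_le_card hsub).trans (Finset.card_image_le.trans ?_)
    simp
  have h3 : 0 < n := Fintype.card_pos
  rw [Nat.card_eq_fintype_card (α := α)] at h1 ⊢
  omega

theorem edgeLength_nonneg {k : ℕ} {X : Finset (EuclideanSpace ℝ (Fin k))} (e : Sym2 X) :
    0 ≤ edgeLength e := by
  induction e using Sym2.ind with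
  | _ x y => exact dist_nonneg (x := (x : EuclideanSpace ℝ (Fin k)))

theorem unscaledCost_le_sum {k : ℕ} {X : Finset (EuclideanSpace ℝ (Fin k))} (G : SimpleGraph X)
    (v : ℕ → X) (par : ℕ → ℕ) (I : Finset ℕ)
    (h : ∀ e ∈ G.edgeSet, ∃ i ∈ I, s(v i, v (par i)) = e) :
    unscaledCost G ≤ ∑ i ∈ I, dist (v i) (v (par i)) ^ k := by
  classical
  unfold unscaledCost
  calc _ ≤ ∑ e ∈ I.image fun i => s(v i, v (par i)), edgeLength e ^ k := by
        refine Finset.sum_le_sum_of_subset_of_nonneg (fun e he => ?_)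
          fun e _ _ => pow_nonneg (edgeLength_nonneg e) _
        rw [SimpleGraph.mem_edgeFinset] at he
        exact Finset.mem_image.2 (h e he)
    _ ≤ ∑ i ∈ I, edgeLength s(v i, v (par i)) ^ k :=
        Finset.sum_image_le_of_nonneg fun e _ => pow_nonneg (edgeLength_nonneg e) _
    _ = _ := rfl

/-! ### Rankin's bound and volumes of overlapping boxes -/

/-- Rankin's bound: few points with large mutual distances lie close to a common point. -/
theorem card_le_six_of_near {E ι : Type*} [NormedAddCommGroup E] [InnerProductSpace ℝ E]
    (F : Finset ι) (p : ι → E) (r : ι → ℝ) (y : E) (hr : ∀ i ∈ F, 0 < r i)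
    (hy : ∀ i ∈ F, ‖p i - y‖ ^ 2 ≤ 5 / 12 * r i ^ 2)
    (hp : ∀ i ∈ F, ∀ j ∈ F, i ≠ j → r i ≤ ‖p i - p j‖) : F.card ≤ 6 := by
  classical
  set q : ι → E := fun i => (r i)⁻¹ • (p i - y) with hq
  have hdiag : ∀ i ∈ F, inner ℝ (q i) (q i) ≤ (5 / 12 : ℝ) := by
    intro i hi
    have h := hy i hi
    have hri := hr i hi
    rw [real_inner_self_eq_norm_sq, hq]
    simp only [norm_smul, norm_inv, Real.norm_eq_abs, abs_of_pos hri, mul_pow, inv_pow]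
    rw [inv_mul_le_iff₀ (by positivity)]
    linarith
  have hoff : ∀ i ∈ F, ∀ j ∈ F, i ≠ j → inner ℝ (q i) (q j) ≤ (-1 / 12 : ℝ) := by
    intro i hi j hj hij
    have hri := hr i hi
    have hrj := hr j hj
    have h1 := hp i hi j hj hij
    have h2 := hp j hj i hi hij.symm
    rw [norm_sub_rev] at h2
    have h3 : ‖p i - p j‖ ^ 2 =
        ‖p i - y‖ ^ 2 - 2 * inner ℝ (p i - y) (p j - y) + ‖p j - y‖ ^ 2 := by
      rw [← norm_sub_sq_real]; congr 2; abel
    have h4 := hy i hi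
    have h5 := hy j hj
    have h6 : r i ^ 2 ≤ ‖p i - p j‖ ^ 2 := by gcongr
    have h7 : r j ^ 2 ≤ ‖p i - p j‖ ^ 2 := by gcongr
    simp only [hq, real_inner_smul_left, real_inner_smul_right]
    rw [inv_mul_le_iff₀ hrj, inv_mul_le_iff₀ hri]
    -- The squared distance is at least `(r i ^ 2 + r j ^ 2) / 2`, so twice the inner product is at
    -- most `(5/12 - 1/2) (r i ^ 2 + r j ^ 2) ≤ -(r i * r j) / 6`.
    nlinarith [sq_nonneg (r i - r j)]
  have hrow : ∀ i ∈ F, ∑ j ∈ F, inner ℝ (q i) (q j) ≤ (1 / 2 : ℝ) - F.card / 12 := by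
    intro i hi
    rw [← Finset.add_sum_erase F _ hi]
    have : ∑ j ∈ F.erase i, inner ℝ (q i) (q j) ≤ ∑ j ∈ F.erase i, (-1 / 12 : ℝ) :=
      Finset.sum_le_sum fun j hj =>
        hoff i hi j (Finset.mem_of_mem_erase hj) (Finset.ne_of_mem_erase hj).symm
    rw [Finset.sum_const, nsmul_eq_mul, Finset.card_erase_of_mem hi,
      Nat.cast_sub (Finset.card_pos.2 ⟨i, hi⟩)] at this
    push_cast at this
    linarith [hdiag i hi]
  have hsum : (0 : ℝ) ≤ F.card * (1 / 2 - F.card / 12 : ℝ) := by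
    calc (0 : ℝ) ≤ inner ℝ (∑ i ∈ F, q i) (∑ i ∈ F, q i) := real_inner_self_nonneg
      _ = ∑ i ∈ F, ∑ j ∈ F, inner ℝ (q i) (q j) := by
        rw [sum_inner]
        exact Finset.sum_congr rfl fun i _ => inner_sum _ _ _
      _ ≤ ∑ i ∈ F, (1 / 2 - F.card / 12 : ℝ) := Finset.sum_le_sum hrow
      _ = _ := by rw [Finset.sum_const, nsmul_eq_mul]
  by_contra! h
  have h' : (7 : ℝ) ≤ F.card := by exact_mod_cast h
  nlinarith

open MeasureTheory

/-- The indicators of the `D i` sum to at most `N` times the indicator of `B`; integrate. -/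
theorem sum_measureReal_le_of_overlap {Ω ι : Type*} [MeasurableSpace Ω] (μ : Measure Ω)
    (F : Finset ι) (D : ι → Set Ω) (B : Set Ω) (N : ℕ) (hD : ∀ i ∈ F, MeasurableSet (D i))
    (hB : MeasurableSet B) (hBfin : μ B ≠ ⊤) (hDB : ∀ i ∈ F, D i ⊆ B)
    (hN : ∀ y, ∀ G ⊆ F, (∀ i ∈ G, y ∈ D i) → G.card ≤ N) :
    ∑ i ∈ F, μ.real (D i) ≤ N * μ.real B := by
  classical
  have hfin : ∀ i ∈ F, μ (D i) ≠ ⊤ := fun i hi => measure_ne_top_of_subset (hDB i hi) hBfin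
  have key : ∑ i ∈ F, μ (D i) ≤ N * μ B := by
    calc ∑ i ∈ F, μ (D i) = ∑ i ∈ F, ∫⁻ y, (D i).indicator 1 y ∂μ :=
          Finset.sum_congr rfl fun i hi => (lintegral_indicator_one (hD i hi)).symm
      _ = ∫⁻ y, ∑ i ∈ F, (D i).indicator 1 y ∂μ := by
          rw [lintegral_finsetSum' _ fun i hi =>
            (measurable_one.indicator (hD i hi)).aemeasurable]
      _ ≤ ∫⁻ y, B.indicator (fun _ => (N : ENNReal)) y ∂μ := by
          refine lintegral_mono fun y => ?_
          by_cases hy : y ∈ B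
          · simp only [Set.indicator_apply, hy, if_true, Pi.one_apply]
            rw [← Finset.sum_filter, Finset.sum_const, nsmul_eq_mul, mul_one]
            exact_mod_cast hN y _ (Finset.filter_subset _ _) fun i hi => (Finset.mem_filter.1 hi).2
          · rw [Finset.sum_eq_zero]
            · simp
            · intro i hi
              exact Set.indicator_of_notMem (fun h => hy (hDB i hi h)) _
      _ = N * μ B := by rw [lintegral_indicator_const hB]
  have := ENNReal.toReal_mono (ENNReal.mul_ne_top (by simp) hBfin) key
  rw [ENNReal.toReal_sum hfin, ENNReal.toReal_mul] at this
  simpa [measureReal_def] using this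

theorem volume_real_box {k : ℕ} (a : Fin k → ℝ) {s : ℝ} (hs : 0 ≤ s) :
    volume.real (Set.Icc a (fun j => a j + s)) = s ^ k := by
  rw [measureReal_def, Real.volume_Icc_pi_toReal (fun j => by simpa using hs)]
  simp

theorem setIntegral_box_coord {k : ℕ} (a : Fin k → ℝ) {s : ℝ} (hs : 0 ≤ s) (f : ℝ → ℝ)
    (j : Fin k) :
    ∫ y in Set.Icc a (fun j => a j + s), f (y j) =
      s ^ (k - 1) * ∫ x in (a j)..(a j + s), f x := by
  classical
  have h1 : (volume : Measure (Fin k → ℝ)).restrict (Set.Icc a (fun j => a j + s)) =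
      Measure.pi fun i => volume.restrict (Set.Icc (a i) (a i + s)) := by
    rw [← Set.pi_univ_Icc, volume_pi, Measure.restrict_pi_pi]
  have h2 : ∀ y : Fin k → ℝ, f (y j) = ∏ i, (if i = j then f (y i) else 1) := by
    intro y; simp
  simp_rw [h2]
  rw [h1, integral_fintype_prod_eq_prod (𝕜 := ℝ)
    (f := fun i x => if i = j then f x else 1), ← Finset.prod_erase_mul _ _ (Finset.mem_univ j)]
  congr 1
  · rw [Finset.prod_congr rfl (g := fun _ => s)]
    · simp
    · intro i hi
      simp [Finset.ne_of_mem_erase hi, hs]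
  · simp [intervalIntegral.integral_of_le (show a j ≤ a j + s by linarith),
      integral_Icc_eq_integral_Ioc]

/-- By Markov's inequality, a box whose points have small mean square distance to `p` has a definite
proportion of its volume close to `p`. -/
theorem mul_pow_le_volume_box_near {k : ℕ} (a p : Fin k → ℝ) {s σ ρ θ : ℝ} (hs : 0 ≤ s)
    (hρ : 0 < ρ) (hσ : ∀ j, ∫ x in (a j)..(a j + s), (x - p j) ^ 2 ≤ σ * s)
    (hσρ : k * σ ≤ (1 - θ) * ρ) :
    θ * s ^ k ≤
      volume.real (Set.Icc a (fun j => a j + s) ∩ {y | ∑ j, (y j - p j) ^ 2 ≤ ρ}) := by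
  set B := Set.Icc a (fun j => a j + s) with hB
  set f : (Fin k → ℝ) → ℝ := fun y => ∑ j, (y j - p j) ^ 2 with hf
  have hfc : Continuous f := by fun_prop
  have hcomp : IsCompact B := isCompact_Icc
  have hint : ∀ g : (Fin k → ℝ) → ℝ, Continuous g → Integrable g (volume.restrict B) :=
    fun g hg => (hg.continuousOn.integrableOn_compact hcomp)
  have hI : ∫ y in B, f y ≤ k * σ * s ^ k := by
    rw [hf, integral_finsetSum _ fun j _ => hint _ (by fun_prop)]
    have : ∀ j ∈ (Finset.univ : Finset (Fin k)), ∫ y in B, (y j - p j) ^ 2 ≤ σ * s ^ k := by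
      intro j _
      have hk : k = k - 1 + 1 := by have := j.2; omega
      rw [setIntegral_box_coord a hs (fun x => (x - p j) ^ 2) j]
      calc _ ≤ s ^ (k - 1) * (σ * s) := by gcongr; exact hσ j
        _ = σ * s ^ k := by conv_rhs => rw [hk, pow_succ]
                            ring
    refine (Finset.sum_le_sum this).trans (le_of_eq ?_)
    simp; ring
  have hM := mul_meas_ge_le_integral_of_nonneg (μ := volume.restrict B) (f := f)
    (ae_of_all _ fun y => Finset.sum_nonneg fun j _ => sq_nonneg _) (hint f hfc) ρ
  have hms : MeasurableSet {y | ρ ≤ f y} := measurableSet_le measurable_const hfc.measurable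
  rw [measureReal_restrict_apply hms] at hM
  have hfin : volume B ≠ ⊤ := hcomp.measure_lt_top.ne
  have hcov : volume.real B ≤ volume.real (B ∩ {y | f y ≤ ρ}) + volume.real ({y | ρ ≤ f y} ∩ B) := by
    refine (measureReal_mono (fun y hy => ?_) ?_).trans (measureReal_union_le _ _)
    · rcases le_total (f y) ρ with h | h
      · exact Or.inl ⟨hy, h⟩
      · exact Or.inr ⟨h, hy⟩
    · exact measure_ne_top_of_subset
        (Set.union_subset Set.inter_subset_left Set.inter_subset_right) hfin
  rw [hB, volume_real_box a hs, ← hB] at hcov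
  have h1 : ρ * volume.real ({y | ρ ≤ f y} ∩ B) ≤ ρ * ((1 - θ) * s ^ k) := by
    have : (k * σ) * s ^ k ≤ ((1 - θ) * ρ) * s ^ k := by gcongr
    linarith
  have h2 := le_of_mul_le_mul_left h1 hρ
  change _ ≤ volume.real (B ∩ {y | f y ≤ ρ})
  linarith

theorem card_le_six_of_coord_near {k : ℕ} {ι : Type*} (F : Finset ι)
    (p : ι → EuclideanSpace ℝ (Fin k)) (r : ι → ℝ) (y : Fin k → ℝ) (hr : ∀ i ∈ F, 0 < r i)
    (hy : ∀ i ∈ F, ∑ j, (y j - p i j) ^ 2 ≤ 5 / 12 * r i ^ 2)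
    (hp : ∀ i ∈ F, ∀ j ∈ F, i ≠ j → r i ≤ dist (p i) (p j)) : F.card ≤ 6 := by
  refine card_le_six_of_near F p r (WithLp.toLp 2 y) hr (fun i hi => ?_)
    fun i hi j hj hij => by simpa [dist_eq_norm] using hp i hi j hj hij
  rw [norm_sub_rev, EuclideanSpace.real_norm_sq_eq]
  simpa using hy i hi

/-- Boxes `Q i` of side `s i`, most of whose mass lies near `p i`, overlap boundedly, so their total
volume is controlled by that of an ambient box. -/
theorem sum_side_pow_le {k : ℕ} {ι : Type*} (F : Finset ι)
    (p : ι → EuclideanSpace ℝ (Fin k)) (r s : ι → ℝ) (a : ι → Fin k → ℝ) (b : Fin k → ℝ) {L θ : ℝ}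
    {σ : ι → ℝ}
    (hr : ∀ i ∈ F, 0 < r i) (hp : ∀ i ∈ F, ∀ j ∈ F, i ≠ j → r i ≤ dist (p i) (p j))
    (hs : ∀ i ∈ F, 0 ≤ s i) (hL : 0 ≤ L) (hab : ∀ i ∈ F, ∀ j, b j ≤ a i j)
    (hab' : ∀ i ∈ F, ∀ j, a i j + s i ≤ b j + L)
    (hσ : ∀ i ∈ F, ∀ j, ∫ x in (a i j)..(a i j + s i), (x - p i j) ^ 2 ≤ σ i * s i)
    (hσr : ∀ i ∈ F, k * σ i ≤ (1 - θ) * (5 / 12 * r i ^ 2)) :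
    θ * ∑ i ∈ F, s i ^ k ≤ 6 * L ^ k := by
  set D : ι → Set (Fin k → ℝ) := fun i =>
    Set.Icc (a i) (fun j => a i j + s i) ∩ {y | ∑ j, (y j - p i j) ^ 2 ≤ 5 / 12 * r i ^ 2} with hD
  set B := Set.Icc b (fun j => b j + L) with hB
  have h1 : ∑ i ∈ F, volume.real (D i) ≤ (6 : ℕ) * volume.real B := by
    refine sum_measureReal_le_of_overlap volume F D B 6 (fun i _ => ?_) measurableSet_Icc
      isCompact_Icc.measure_lt_top.ne (fun i hi => ?_) fun y G hG hy => ?_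
    · refine measurableSet_Icc.inter (measurableSet_le ?_ measurable_const)
      fun_prop
    · refine Set.inter_subset_left.trans (Set.Icc_subset_Icc (fun j => hab i hi j) fun j => ?_)
      exact hab' i hi j
    · exact card_le_six_of_coord_near G p r y (fun i hi => hr i (hG hi)) (fun i hi => (hy i hi).2)
        fun i hi j hj => hp i (hG hi) j (hG hj)
  rw [hB, volume_real_box b hL] at h1
  rw [Finset.mul_sum]
  refine le_trans (Finset.sum_le_sum fun i hi => ?_) h1
  have := hr i hi
  exact mul_pow_le_volume_box_near (a i) (fun j => p i j) (hs i hi) (by positivity) (hσ i hi)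
    (hσr i hi)

/-! ### Packing in the cube: long and short edges -/

theorem integral_sub_sq (a s p : ℝ) :
    ∫ x in a..(a + s), (x - p) ^ 2 = ((a + s - p) ^ 3 - (a - p) ^ 3) / 3 := by
  rw [intervalIntegral.integral_comp_sub_right (fun x => x ^ 2), integral_pow]
  norm_num

/-- Packing bound for separated points of the cube. -/
theorem card_mul_pow_le_of_separated {k : ℕ} {ι : Type*} (F : Finset ι)
    (p : ι → EuclideanSpace ℝ (Fin k)) (hcube : ∀ i ∈ F, p i ∈ unitCube k) {s : ℝ} (hs : 0 < s)
    (hs1 : s ≤ 1) (hk : 0 < k) (hp : ∀ i ∈ F, ∀ j ∈ F, i ≠ j → s * √k ≤ dist (p i) (p j)) :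
    F.card * s ^ k ≤ 30 := by
  have hk' : (0 : ℝ) < k := by exact_mod_cast hk
  -- The box is the cube contracted by `s` towards `p i`, so it stays inside the cube. Its mean
  -- square per coordinate is at most `s ^ 2 / 3`, the value when `p i` is at an end, and `(1 - 1/5)
  -- * 5/12 = 1/3`.
  have := sum_side_pow_le F p (fun _ => s * √k) (fun _ => s) (fun i j => (1 - s) * p i j)
    (fun _ => 0) (L := 1) (θ := 1 / 5) (σ := fun _ => s ^ 2 / 3) (fun i _ => by positivity) hp
    (fun _ _ => hs.le) zero_le_one
    (fun i hi j => mul_nonneg (by linarith) (hcube i hi j).1)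
    (fun i hi j => by nlinarith [(hcube i hi j).2])
    (fun i hi j => by
      obtain ⟨h0, h1⟩ := hcube i hi j
      rw [integral_sub_sq]
      have : ((1 - s) * p i j + s - p i j) ^ 3 - ((1 - s) * p i j - p i j) ^ 3 =
        s ^ 2 * s * (1 - 3 * (p i j * (1 - p i j))) := by ring
      rw [this]
      have h2 : 0 ≤ p i j * (1 - p i j) := mul_nonneg h0 (by linarith)
      have h3 : 0 ≤ s ^ 2 * s := by positivity
      nlinarith)
    (fun i _ => by
      rw [mul_pow, Real.sq_sqrt hk'.le]
      exact le_of_eq (by ring))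
  rw [Finset.sum_const, nsmul_eq_mul, one_pow] at this
  linarith

/-- Volume bound for points of the cube each separated from the others by its own small radius. -/
theorem sum_pow_le_of_separated {k : ℕ} {ι : Type*} (F : Finset ι)
    (p : ι → EuclideanSpace ℝ (Fin k)) (hcube : ∀ i ∈ F, p i ∈ unitCube k) (s : ι → ℝ)
    (hs : ∀ i ∈ F, 0 < s i) (hs1 : ∀ i ∈ F, s i ≤ 1 / 11) (hk : 0 < k)
    (hp : ∀ i ∈ F, ∀ j ∈ F, i ≠ j → s i * √k / 2 ≤ dist (p i) (p j)) :
    ∑ i ∈ F, s i ^ k ≤ 375 / 2 := by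
  have hk' : (0 : ℝ) < k := by exact_mod_cast hk
  -- Centred boxes overhang the cube by at most `1/20` as `s i ≤ 1/11`. Scaling their sides by the
  -- same `11/10` as the ambient cube makes the factor `(11/10) ^ k` cancel. Markov still leaves `θ
  -- = 1 - 1.21/1.25 = 4/125`.
  have := sum_side_pow_le F p (fun i => s i * √k / 2) (fun i => 11 / 10 * s i)
    (fun i j => p i j - 11 / 20 * s i)
    (fun _ => -1 / 20) (L := 11 / 10) (θ := 4 / 125) (σ := fun i => (11 / 10 * s i) ^ 2 / 12)
    (fun i hi => by have := hs i hi; positivity) hp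
    (fun i hi => by have := hs i hi; positivity) (by norm_num)
    (fun i hi j => by linarith [(hcube i hi j).1, hs1 i hi])
    (fun i hi j => by linarith [(hcube i hi j).2, hs1 i hi])
    (fun i hi j => by
      rw [integral_sub_sq]
      exact le_of_eq (by ring))
    (fun i _ => by
      rw [div_pow, mul_pow (s i), Real.sq_sqrt hk'.le]
      exact le_of_eq (by ring))
  simp_rw [mul_pow] at this
  rw [← Finset.mul_sum] at this
  have h2 : (0 : ℝ) < (11 / 10) ^ k := by positivity
  have h3 : (11 / 10 : ℝ) ^ k * (4 / 125 * ∑ i ∈ F, s i ^ k) ≤ (11 / 10 : ℝ) ^ k * 6 := by linarith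
  have := le_of_mul_le_mul_left h3 h2
  linarith

/-- The hypothesis says that the `m`-th largest value is at most `C / m`; the induction adds the
values in decreasing order. -/
theorem sum_le_mul_harmonic {ι : Type*} [DecidableEq ι] (x : ι → ℝ) {C : ℝ} (A : Finset ι)
    (h : ∀ B ⊆ A, ∀ i ∈ B, (∀ j ∈ B, x i ≤ x j) → B.card * x i ≤ C) :
    ∑ i ∈ A, x i ≤ C * harmonic A.card := by
  induction A using Finset.induction_on_min_value x with
  | empty => simp
  | insert a s ha hmin ih =>
    have h1 := ih fun B hB => h B (hB.trans (Finset.subset_insert _ _))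
    have h2 := h _ subset_rfl a (Finset.mem_insert_self _ _) (by
      intro j hj
      rcases Finset.mem_insert.1 hj with rfl | hj
      · rfl
      · exact hmin j hj)
    rw [Finset.card_insert_of_notMem ha] at h2 ⊢
    rw [Finset.sum_insert ha, harmonic_succ]
    push_cast at h2 ⊢
    have h3 : x a ≤ C * ((s.card : ℝ) + 1)⁻¹ := by
      rw [← div_eq_mul_inv, le_div_iff₀ (by positivity)]
      linarith
    linarith

/-- The combined estimate for both long and short lengths. -/
theorem sum_pow_le_linear {k : ℕ} {ι : Type*} (I : Finset ι)
    (v m : ι → EuclideanSpace ℝ (Fin k)) (s : ι → ℝ) (hk : 0 < k)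
    (hv : ∀ i ∈ I, v i ∈ unitCube k) (hm : ∀ i ∈ I, m i ∈ unitCube k)
    (hs : ∀ i ∈ I, 0 < s i) (hs1 : ∀ i ∈ I, s i ≤ 1)
    (hvv : ∀ i ∈ I, ∀ j ∈ I, i ≠ j → min (s i) (s j) * √k ≤ dist (v i) (v j))
    (hmm : ∀ i ∈ I, ∀ j ∈ I, i ≠ j → s i * √k / 2 ≤ dist (m i) (m j)) :
    ∑ i ∈ I, s i ^ k ≤ 2000 * k := by
  classical
  have hk1 : (1 : ℝ) ≤ k := by exact_mod_cast hk
  have hpack : ∀ B ⊆ I, ∀ t, 0 < t → t ≤ 1 → (∀ j ∈ B, t ≤ s j) → B.card * t ^ k ≤ 30 := by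
    intro B hB t ht ht1 hmin
    refine card_mul_pow_le_of_separated B v (fun j hj => hv j (hB hj)) ht ht1 hk ?_
    intro i hi j hj hij
    refine le_trans ?_ (hvv i (hB hi) j (hB hj) hij)
    gcongr
    exact le_min (hmin i hi) (hmin j hj)
  rw [← Finset.sum_filter_add_sum_filter_not I (fun i => s i ≤ 1 / 11)]
  have hshort : ∑ i ∈ I with s i ≤ 1 / 11, s i ^ k ≤ 375 / 2 := by
    refine sum_pow_le_of_separated _ m (fun i hi => hm i (Finset.mem_of_mem_filter i hi)) s
      (fun i hi => hs i (Finset.mem_of_mem_filter i hi)) (fun i hi => (Finset.mem_filter.1 hi).2) hk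
      fun i hi j hj => hmm i (Finset.mem_of_mem_filter i hi) j (Finset.mem_of_mem_filter j hj)
  set A := I.filter fun i => ¬ s i ≤ 1 / 11 with hA
  have hAI : A ⊆ I := Finset.filter_subset _ _
  have hlong : ∑ i ∈ A, s i ^ k ≤ 30 * harmonic A.card := by
    refine sum_le_mul_harmonic _ A fun B hB i hi hmin => ?_
    have hiI := hAI (hB hi)
    refine hpack B (hB.trans hAI) (s i) (hs i hiI) (hs1 i hiI) fun j hj => ?_
    exact (pow_le_pow_iff_left₀ (hs i hiI).le (hs j (hAI (hB hj))).le hk.ne').1 (hmin j hj)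
  -- Long edges have `s i > 1/11`, so their number is at most exponential in `k` and its logarithm
  -- linear.
  have hcard : (A.card : ℝ) ≤ 30 * 11 ^ k := by
    have := hpack A hAI (1 / 11) (by norm_num) (by norm_num)
      fun j hj => (not_le.1 (Finset.mem_filter.1 hj).2).le
    rwa [one_div, inv_pow, ← div_eq_mul_inv, div_le_iff₀ (by positivity)] at this
  have hlog : Real.log A.card ≤ 29 + k * 10 := by
    rcases Nat.eq_zero_or_pos A.card with h0 | h0
    · rw [h0]; simp; positivity
    · have h0' : (0 : ℝ) < A.card := by exact_mod_cast h0
      calc Real.log A.card ≤ Real.log (30 * 11 ^ k) := Real.log_le_log h0' hcard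
        _ = Real.log 30 + k * Real.log 11 := by
          rw [Real.log_mul (by norm_num) (by positivity), Real.log_pow]
        _ ≤ 29 + k * 10 := by
          have h1 := Real.log_le_sub_one_of_pos (show (0 : ℝ) < 30 by norm_num)
          have h2 := Real.log_le_sub_one_of_pos (show (0 : ℝ) < 11 by norm_num)
          nlinarith
  have hharm := harmonic_le_one_add_log A.card
  linarith

/-! ### Separation of edge midpoints -/

theorem dist_le_sqrt_of_mem_unitCube {k : ℕ} {x y : EuclideanSpace ℝ (Fin k)}
    (hx : x ∈ unitCube k) (hy : y ∈ unitCube k) : dist x y ≤ √k := by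
  rw [EuclideanSpace.dist_eq]
  refine Real.sqrt_le_sqrt ?_
  calc ∑ i, dist (x i) (y i) ^ 2 ≤ ∑ _i : Fin k, (1 : ℝ) := by
        refine Finset.sum_le_sum fun i _ => ?_
        have : dist (x i) (y i) ≤ 1 := by simpa using Real.dist_le_of_mem_Icc (hx i) (hy i)
        exact pow_le_one₀ dist_nonneg this
    _ = k := by simp

theorem midpoint_mem_unitCube {k : ℕ} {x y : EuclideanSpace ℝ (Fin k)}
    (hx : x ∈ unitCube k) (hy : y ∈ unitCube k) : midpoint ℝ x y ∈ unitCube k := by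
  intro i
  have : midpoint ℝ x y i = (x i + y i) / 2 := by
    simp [midpoint_eq_smul_add]; ring
  rw [this]
  constructor
  · linarith [(hx i).1, (hy i).1]
  · linarith [(hx i).2, (hy i).2]

theorem four_mul_dist_midpoint_sq {E : Type*} [NormedAddCommGroup E] [InnerProductSpace ℝ E]
    (a b c d : E) :
    4 * dist (midpoint ℝ a b) (midpoint ℝ c d) ^ 2 =
      dist c a ^ 2 + dist c b ^ 2 + dist d a ^ 2 + dist d b ^ 2 - dist a b ^ 2 - dist c d ^ 2 := by
  have h : midpoint ℝ a b - midpoint ℝ c d = (2⁻¹ : ℝ) • ((a + b) - (c + d)) := by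
    simp only [midpoint_eq_smul_add, invOf_eq_inv, smul_sub]
  simp only [dist_eq_norm]
  rw [h, norm_smul, mul_pow]
  simp only [← real_inner_self_eq_norm_sq, inner_sub_left, inner_sub_right, inner_add_left,
    inner_add_right]
  rw [real_inner_comm a b, real_inner_comm a c, real_inner_comm a d, real_inner_comm b c,
    real_inner_comm b d, real_inner_comm c d]
  norm_num
  ring

/-- Midpoints of the edges of a Prim tree are separated. -/
theorem max_le_two_mul_dist_midpoint {E : Type*} [NormedAddCommGroup E] [InnerProductSpace ℝ E]
    {n : ℕ} (v : ℕ → E) (par : ℕ → ℕ) (hpar : ∀ i, 0 < i → i < n → par i < i)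
    (hprim : ∀ a i j, a < i → i ≤ j → j < n → dist (v i) (v (par i)) ≤ dist (v j) (v a))
    {i j : ℕ} (hi : 0 < i) (hij : i < j) (hj : j < n) :
    max (dist (v i) (v (par i))) (dist (v j) (v (par j))) ≤
      2 * dist (midpoint ℝ (v i) (v (par i))) (midpoint ℝ (v j) (v (par j))) := by
  have hpi := hpar i hi (by omega)
  have hpj := hpar j (by omega) hj
  have h1 := hprim i j j hij le_rfl hj
  have h2 : max (dist (v i) (v (par i))) (dist (v j) (v (par j))) ≤ dist (v j) (v (par i)) :=
    max_le (hprim _ i j hpi hij.le hj) (hprim _ j j (by omega) le_rfl hj)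
  have hm := four_mul_dist_midpoint_sq (v i) (v (par i)) (v j) (v (par j))
  set M := max (dist (v i) (v (par i))) (dist (v j) (v (par j))) with hM
  have hM0 : 0 ≤ M := le_max_of_le_left dist_nonneg
  have hsq1 : dist (v j) (v (par j)) ^ 2 ≤ dist (v j) (v i) ^ 2 := by gcongr
  have hsq2 : M ^ 2 ≤ dist (v j) (v (par i)) ^ 2 := by gcongr
  have hsq3 : dist (v i) (v (par i)) ^ 2 ≤
      dist (v (par j)) (v i) ^ 2 + dist (v (par j)) (v (par i)) ^ 2 := by
    -- Only one of the two distances is controlled, since `par j` may equal `i` or `par i`. If `par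
    -- j` precedes `i`, compare with the choice of `v i`; otherwise `v (par j)` was itself a
    -- candidate at that stage.
    rcases lt_or_ge (par j) i with h | h
    · have := hprim _ i i h le_rfl (by omega)
      rw [dist_comm (v (par j)) (v i)]
      have : dist (v i) (v (par i)) ^ 2 ≤ dist (v i) (v (par j)) ^ 2 := by gcongr
      nlinarith [sq_nonneg (dist (v (par j)) (v (par i)))]
    · have := hprim _ i (par j) hpi h (by omega)
      have : dist (v i) (v (par i)) ^ 2 ≤ dist (v (par j)) (v (par i)) ^ 2 := by gcongr
      nlinarith [sq_nonneg (dist (v (par j)) (v i))]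
  refine (pow_le_pow_iff_left₀ hM0 (by positivity) two_ne_zero).1 ?_
  linarith

/-! ### Cost of the Prim tree and the two bounds -/

theorem exists_isTree_unscaledCost_le {k : ℕ} (hk : 0 < k) (X : Finset (EuclideanSpace ℝ (Fin k)))
    (hX : (X : Set (EuclideanSpace ℝ (Fin k))) ⊆ unitCube k) (hcard : 2 ≤ X.card) :
    ∃ G : SimpleGraph X, G.IsTree ∧ unscaledCost G ≤ 2000 * k * √k ^ k := by
  classical
  have hne : Nonempty X := (Finset.card_pos.1 (by omega)).to_subtype
  obtain ⟨v, par, hinj, hpar, hprim⟩ := exists_prim (α := X)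
  obtain ⟨G, hG, hGe⟩ := exists_isTree_of_parent v par hinj hpar
  refine ⟨G, hG, (unscaledCost_le_sum G v par _ hGe).trans ?_⟩
  set n := Fintype.card X with hn
  have hk' : (0 : ℝ) < √k := Real.sqrt_pos.2 (by exact_mod_cast hk)
  set w : ℕ → EuclideanSpace ℝ (Fin k) := fun i => (v i : EuclideanSpace ℝ (Fin k)) with hw
  have hwc : ∀ i, w i ∈ unitCube k := fun i => hX (v i).2
  set s : ℕ → ℝ := fun i => dist (w i) (w (par i)) / √k with hs
  have hsk : ∀ i, s i * √k = dist (w i) (w (par i)) := fun i => div_mul_cancel₀ _ hk'.ne'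
  have hprim' : ∀ a i j, a < i → i ≤ j → j < n → dist (w i) (w (par i)) ≤ dist (w j) (w a) := hprim
  have hvv : ∀ i j, i < j → j < n → min (s i) (s j) * √k ≤ dist (w j) (w i) := by
    intro i j hij hj
    calc min (s i) (s j) * √k ≤ s j * √k := by gcongr; exact min_le_right _ _
      _ ≤ _ := by rw [hsk]; exact hprim' i j j hij le_rfl hj
  have hmm : ∀ i j, 0 < i → i < j → j < n → max (s i) (s j) * √k / 2 ≤
      dist (midpoint ℝ (w i) (w (par i))) (midpoint ℝ (w j) (w (par j))) := by
    intro i j hi hij hj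
    have := max_le_two_mul_dist_midpoint w par hpar hprim' hi hij hj
    rw [max_mul_of_nonneg _ _ hk'.le, hsk, hsk]
    linarith
  have key := sum_pow_le_linear (Finset.Ico 1 n) w (fun i => midpoint ℝ (w i) (w (par i))) s hk
    (fun i _ => hwc i) (fun i _ => midpoint_mem_unitCube (hwc i) (hwc _))
    (fun i hi => by
      rw [Finset.mem_Ico] at hi
      refine div_pos (dist_pos.2 fun h => ?_) hk'
      have h1 := hpar i hi.1 hi.2
      have := hinj (by simpa using hi.2) (by simp; omega) (Subtype.ext h)
      omega)
    (fun i _ => (div_le_one hk').2 (dist_le_sqrt_of_mem_unitCube (hwc i) (hwc _)))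
    (fun i hi j hj hij => by
      rw [Finset.mem_Ico] at hi hj
      rcases lt_or_gt_of_ne hij with h | h
      · rw [dist_comm]; exact hvv i j h hj.2
      · rw [min_comm]; exact hvv j i h hi.2)
    (fun i hi j hj hij => by
      rw [Finset.mem_Ico] at hi hj
      rcases lt_or_gt_of_ne hij with h | h
      · refine le_trans ?_ (hmm i j hi.1 h hj.2)
        gcongr
        exact le_max_left _ _
      · rw [dist_comm]
        refine le_trans ?_ (hmm j i hj.1 h hi.2)
        gcongr
        exact le_max_right _ _)
  calc ∑ i ∈ Finset.Ico 1 n, dist (v i) (v (par i)) ^ k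
      = (∑ i ∈ Finset.Ico 1 n, s i ^ k) * √k ^ k := by
        rw [Finset.sum_mul]
        refine Finset.sum_congr rfl fun i _ => ?_
        rw [← mul_pow, hsk]
        rfl
    _ ≤ _ := by gcongr

theorem unscaledCost_nonneg {k : ℕ} {X : Finset (EuclideanSpace ℝ (Fin k))} (G : SimpleGraph X) :
    0 ≤ unscaledCost G :=
  Finset.sum_nonneg fun e _ => pow_nonneg (edgeLength_nonneg e) _

theorem stSup_le {k : ℕ} (hk : 0 < k) :
    stSup k ≤ ENNReal.ofReal (√k * (2000 * k : ℝ) ^ (1 / (k : ℝ))) := by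
  refine iSup₂_le fun n hn => iSup_le fun X => iSup₂_le fun hX hc => ?_
  obtain ⟨G, hG, hcost⟩ := exists_isTree_unscaledCost_le hk X hX (by omega)
  refine (iInf₂_le G hG).trans (ENNReal.ofReal_le_ofReal ?_)
  calc scaledCost G ≤ (2000 * k * √k ^ k) ^ (1 / (k : ℝ)) :=
        Real.rpow_le_rpow (unscaledCost_nonneg G) hcost (by positivity)
    _ = √k * (2000 * k : ℝ) ^ (1 / (k : ℝ)) := by
        rw [Real.mul_rpow (by positivity) (by positivity), one_div,
          Real.pow_rpow_inv_natCast (by positivity) hk.ne', mul_comm]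

/-- Any tree on two opposite corners must contain the diagonal, of length `√k`. -/
theorem le_stSup {k : ℕ} (hk : 0 < k) : ENNReal.ofReal √k ≤ stSup k := by
  classical
  set a : EuclideanSpace ℝ (Fin k) := WithLp.toLp 2 fun _ => 0 with ha
  set b : EuclideanSpace ℝ (Fin k) := WithLp.toLp 2 fun _ => 1 with hb
  have hab : a ≠ b := fun h => by
    have := congrArg (fun x : EuclideanSpace ℝ (Fin k) => x ⟨0, hk⟩) h
    simp [ha, hb] at this
  have hdist : dist a b = √k := by
    rw [EuclideanSpace.dist_eq]; simp [ha, hb]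
  set X : Finset (EuclideanSpace ℝ (Fin k)) := {a, b} with hX
  have hXc : (X : Set (EuclideanSpace ℝ (Fin k))) ⊆ unitCube k := by
    intro x hx i
    rcases Finset.mem_insert.1 (Finset.mem_coe.1 hx) with rfl | hx
    · simp [ha]
    · rw [Finset.mem_singleton.1 hx]; simp [hb]
  refine le_trans ?_ (le_iSup₂_of_le (f := fun n (_ : 2 ≤ n) => stSupCard k n) 2 le_rfl
    (le_iSup_of_le X (le_iSup₂_of_le (f := fun _ _ => stCost X) hXc (Finset.card_pair hab) le_rfl)))
  refine le_iInf₂ fun G hG => ENNReal.ofReal_le_ofReal ?_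
  set a' : X := ⟨a, by simp [hX]⟩ with ha'
  set b' : X := ⟨b, by simp [hX]⟩ with hb'
  have hab' : a' ≠ b' := fun h => hab (congrArg Subtype.val h)
  have hadj : G.Adj a' b' := by
    have : Nontrivial X := ⟨a', b', hab'⟩
    obtain ⟨c, hc⟩ := hG.connected.preconnected.exists_adj_of_nontrivial a'
    have : c = a' ∨ c = b' := by
      rcases Finset.mem_insert.1 c.2 with h | h
      · exact Or.inl (Subtype.ext h)
      · exact Or.inr (Subtype.ext (Finset.mem_singleton.1 h))
    rcases this with rfl | rfl
    · exact (hc.ne rfl).elim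
    · exact hc
  have hle : √k ^ k ≤ unscaledCost G := by
    rw [← hdist]
    unfold unscaledCost
    exact Finset.single_le_sum (f := fun e : Sym2 X => edgeLength e ^ k)
      (fun e _ => pow_nonneg (edgeLength_nonneg e) _)
      (SimpleGraph.mem_edgeFinset.2 ((SimpleGraph.mem_edgeSet G).2 hadj))
  calc √k = (√k ^ k) ^ (1 / (k : ℝ)) := by
        rw [one_div, Real.pow_rpow_inv_natCast (by positivity) hk.ne']
    _ ≤ scaledCost G := Real.rpow_le_rpow (by positivity) hle (by positivity)

theorem tendsto_linear_rpow_inv :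
    Tendsto (fun k : ℕ => (2000 * k : ℝ) ^ (1 / (k : ℝ))) atTop (𝓝 1) := by
  have h1 : Tendsto (fun k : ℕ => (k : ℝ) ^ (1 / (k : ℝ))) atTop (𝓝 1) :=
    tendsto_rpow_div.comp tendsto_natCast_atTop_atTop
  have h2 : Tendsto (fun k : ℕ => (2000 : ℝ) ^ (1 / (k : ℝ))) atTop (𝓝 1) := by
    have := (Real.continuousAt_const_rpow (a := 2000) (b := 0) (by norm_num)).tendsto.comp
      (tendsto_one_div_atTop_nhds_zero_nat (𝕜 := ℝ))
    simpa [Function.comp_def] using this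
  have := h2.mul h1
  rw [one_mul] at this
  refine this.congr fun k => ?_
  rw [Real.mul_rpow (by norm_num) (by positivity)]

theorem theorem4 :
    (∃ ε : ℕ → ℝ, Tendsto ε atTop (𝓝 0) ∧
      ∀ k : ℕ, 1 ≤ k → stSup k ≤ ENNReal.ofReal (√(k : ℝ) * (1 + ε k))) ∧
    (∀ k : ℕ, 1 ≤ k → ENNReal.ofReal √(k : ℝ) ≤ stSup k) := by
  refine ⟨⟨fun k => (2000 * k : ℝ) ^ (1 / (k : ℝ)) - 1, ?_, fun k hk => ?_⟩, fun k hk => le_stSup hk⟩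
  · simpa using tendsto_linear_rpow_inv.sub_const 1
  · simpa using stSup_le hk
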